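/- Let $d,n\in\mathbb N$, let the state $\omega\in\mathbb R^d$ have prior $\mu=\mathcal N(0,I)$, let $\theta_1,\dots,\theta_n\in\mathbb R^d$, and let $f=(f_1,\dots,f_n)$ be a probability vector. With probability $f_i$ the buyer has type $i$ and utility $u^i(\omega,a)=-(\theta_i^\top\omega-a)^2$ for actions $a\in\mathbb R$. An experiment $E=(S,\pi)$ consists of a measurable signal space $S$ and a Markov kernel $\pi$ from $\mathbb R^d$ to $S$. Its value for type $i$ is $V(E,i)=\mathbb E_{s}\big[\max_{a\in\mathbb R}\mathbb E[u^i(\omega,a)\mid s]\big]$, where $\omega\sim\mu$ and $s\sim\pi(\cdot\mid\omega)$; without an experiment the type obtains $u^i=\max_{a\in\mathbb R}\mathbb E_{\omega\sim\mu}[u^i(\omega,a)]$. A menu is a family of experiments $E$ with prices $t(E)\ge 0$. Each type $i$ either buys an experiment that maximizes $V(E,i)-t(E)$ over the menu, with $V(E,i)-t(E)\ge u^i$, or buys nothing, if no experiment in the menu gives it more than $u^i$. The revenue is the expected payment, with weights $f_i$ on the types. A menu, together with such optimal purchases, is revenue-maximizing if no menu with any optimal purchases of the buyer types has a larger revenue.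 Then there is a revenue-maximizing menu $\{(E^j,t^j)\}_{j=1}^n$, in which type $i$ purchases $E^i$ (that is, $V(E^i,i)-t^i\ge V(E^j,i)-t^j$ and $V(E^i,i)-t^i\ge u^i$ for all $i,j$), such that each $E^j$ is a scalar Gaussian experiment: in state $\omega$ its signal has law $\mathcal N(v_j^\top\omega,\sigma_j^2)$ for some $v_j\in\mathbb R^d$ and $\sigma_j^2\ge 0$. Moreover, the same parameters satisfy $\|v_j\|^2+\sigma_j^2>0$ and $$V(E^j,i)=\frac{(v_j^\top\theta_i)^2}{\|v_j\|^2+\sigma_j^2}-\|\theta_i\|^2\qquad\text{for all } i,j\in\{1,\dots,n\}.$$ -/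

import Mathlib

open MeasureTheory ProbabilityTheory
open scoped NNReal

set_option linter.checkUnivs false

universe u w u' w'

namespace InfoPricing

noncomputable section

/-- The state space `ℝ^d`. -/
abbrev State (d : ℕ) : Type := EuclideanSpace ℝ (Fin d)

/-- The common prior `N(0, I)` on `ℝ^d`. -/
def prior (d : ℕ) : Measure (State d) := stdGaussian (State d)

instance (d : ℕ) : IsProbabilityMeasure (prior d) :=
  inferInstanceAs (IsProbabilityMeasure (stdGaussian (State d)))

/-- The (ex-post) utility `-(θᵀω - a)²` of a buyer with preference vector `θ`
who takes the action `a : ℝ` in state `ω`. -/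
def utility {d : ℕ} (θ : State d) (ω : State d) (a : ℝ) : ℝ :=
  -(inner ℝ θ ω - a) ^ 2

/-- The expected utility of the best action under the belief `ν` about the state. -/
def bestUtility {d : ℕ} (θ : State d) (ν : Measure (State d)) : ℝ :=
  ⨆ a : ℝ, ∫ ω, utility θ ω a ∂ν

/-- A statistical experiment: an arbitrary measurable space of signals and a Markov kernel
that maps each state to a probability distribution over signals. -/
structure Experiment (d : ℕ) : Type (u + 1) where
  /-- the space of signals -/
  Signal : Type u
  /-- its measurable structure -/
  [measurableSpace : MeasurableSpace Signal]
  /-- the signaling function -/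
  kernel : Kernel (State d) Signal
  [isMarkov : IsMarkovKernel kernel]

attribute [instance] Experiment.measurableSpace Experiment.isMarkov

/-- The distribution of the signal when the state is drawn from the prior. -/
def Experiment.signalLaw {d : ℕ} (E : Experiment.{u} d) : Measure E.Signal :=
  (prior d).bind E.kernel

/-- The posterior belief about the state after observing the signal `s`, that is, the regular
conditional distribution of the state given the signal. -/
def Experiment.posteriorBelief {d : ℕ} (E : Experiment.{u} d) (s : E.Signal) :
    Measure (State d) :=
  posterior E.kernel (prior d) s

/-- The value `V(E, i)` of the experiment `E` for a buyer with preference vector `θ = θ_i`: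
the expectation, over the signal, of the posterior expected utility of the best action. -/
def Experiment.value {d : ℕ} (E : Experiment.{u} d) (θ : State d) : ℝ :=
  ∫ s, bestUtility θ (E.posteriorBelief s) ∂E.signalLaw

/-- The kernel `ω ↦ N(vᵀω, σ²)` (the point mass at `vᵀω` when `σ² = 0`). -/
def gaussianKernel {d : ℕ} (v : State d) (σsq : ℝ≥0) : Kernel (State d) ℝ where
  toFun := fun ω => gaussianReal (inner ℝ v ω) σsq
  measurable' :=
    measurable_gaussianReal.comp
      (Measurable.prodMk (f := fun ω : State d => (inner ℝ v ω : ℝ))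
        (by fun_prop) measurable_const)

instance {d : ℕ} (v : State d) (σsq : ℝ≥0) : IsMarkovKernel (gaussianKernel v σsq) :=
  ⟨fun ω => inferInstanceAs (IsProbabilityMeasure (gaussianReal (inner ℝ v ω) σsq))⟩

/-- The scalar Gaussian experiment, whose signal in state `ω` has law `N(vᵀω, σ²)`. -/
def gaussianExperiment {d : ℕ} (v : State d) (σsq : ℝ≥0) : Experiment.{0} d where
  Signal := ℝ
  kernel := gaussianKernel v σsq

/-- A menu: a (possibly infinite) family of experiments offered for sale, with nonnegative
prices. -/
structure Menu (d : ℕ) : Type (max (u + 1) (w + 1)) where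
  /-- the labels of the entries of the menu -/
  Item : Type w
  /-- the experiment on offer -/
  experiment : Item → Experiment.{u} d
  /-- its price -/
  price : Item → ℝ≥0

namespace Menu

variable {d n : ℕ}

/-- The net expected utility of a buyer with preference vector `θ` who buys the given entry of
the menu, or who buys nothing (`none`) and acts on the prior. -/
def netUtility (M : Menu.{u, w} d) (θ : State d) : Option M.Item → ℝ
  | none => bestUtility θ (prior d)
  | some j => (M.experiment j).value θ - M.price j

/-- The payment made by a buyer who buys the given entry, or nothing. -/
def payment (M : Menu.{u, w} d) : Option M.Item → ℝ
  | none => 0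
  | some j => M.price j

/-- The purchases `c`, one for each of the `n` types, are optimal for the buyer: each type
weakly prefers its purchase to every entry of the menu (incentive compatibility) and to
buying nothing (individual rationality). -/
def IsOptimalChoice (M : Menu.{u, w} d) (θ : Fin n → State d)
    (c : Fin n → Option M.Item) : Prop :=
  ∀ (i : Fin n) (o : Option M.Item), M.netUtility (θ i) o ≤ M.netUtility (θ i) (c i)

/-- The expected revenue when type `i` has probability `f i` and purchases `c i`. -/
def revenue (M : Menu.{u, w} d) (f : Fin n → ℝ) (c : Fin n → Option M.Item) : ℝ :=
  ∑ i, f i * M.payment (c i)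

/-- The menu `M` is revenue-maximizing with purchases `c`: these purchases are optimal for the
buyer, and no menu earns more under any purchases that are optimal for the buyer. -/
def IsRevenueMaximizing (M : Menu.{u, w} d) (θ : Fin n → State d) (f : Fin n → ℝ)
    (c : Fin n → Option M.Item) : Prop :=
  M.IsOptimalChoice θ c ∧
    ∀ (M' : Menu.{u', w'} d) (c' : Fin n → Option M'.Item),
      M'.IsOptimalChoice θ c' → M'.revenue f c' ≤ M.revenue f c

/-- The direct menu, with one experiment and one price for each type. -/
def direct (E : Fin n → Experiment.{u} d) (t : Fin n → ℝ≥0) : Menu.{u, 0} d where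
  Item := Fin n
  experiment := E
  price := t

end Menu

end

end InfoPricing

namespace InfoPricing

noncomputable section

/-! ### The value of an experiment as a quadratic form -/

section Value

variable {d : ℕ}

/-! Quadratic loss makes the value of `E` equal to `θᵀBθ - ‖θ‖²`, where `B` is the second moment of
the posterior mean (`value_eq`) and `0 ≤ B ≤ I`. For the type `θ₀` that buys `E`, put `w = Bθ₀ /
√(θ₀ᵀBθ₀)`. Cauchy–Schwarz gives `wwᵀ ≤ B`, with equality at `θ₀` (`exists_rankOne`): the buyer
keeps its value and no other type finds its purchase more attractive. Prices being unchanged, every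
menu earns what some feasible mechanism of directions in the unit ball and prices earns
(`Menu.IsOptimalChoice.exists_feasible`).

Such mechanisms form a compact set, so a best one exists. It is realized by Gaussian signals: by
linear regression (`value_gaussianExperiment`), direction `w` with noise variance `1 - ‖w‖²` yields
exactly `(wᵀθ)² - ‖θ‖²`. -/

lemma memLp_inner_prior (θ : State d) : MemLp (fun ω => (inner ℝ θ ω : ℝ)) 2 (prior d) := by
  have h : MemLp id 2 (prior d) := IsGaussian.memLp_two_id (μ := stdGaussian (State d))
  exact h.const_inner θ

lemma integral_inner_prior (θ : State d) : ∫ ω, (inner ℝ θ ω : ℝ) ∂(prior d) = 0 :=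
  integral_strongDual_stdGaussian (E := State d) (innerSL ℝ θ)

lemma integral_inner_mul_inner_prior (θ η : State d) :
    ∫ ω, (inner ℝ θ ω : ℝ) * inner ℝ η ω ∂(prior d) = inner ℝ θ η := by
  have h := covarianceBilin_stdGaussian (E := State d)
  have h2 := covarianceBilin_apply_eq_cov (μ := prior d)
    (IsGaussian.memLp_two_id (μ := stdGaussian (State d))) θ η
  have h3 : covarianceBilin (prior d) θ η = inner ℝ θ η := by
    simp only [prior]; rw [h]; rfl
  rw [← h3, h2, covariance_eq_sub (memLp_inner_prior θ) (memLp_inner_prior η)]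
  simp [integral_inner_prior]

lemma integral_inner_sq_prior (θ : State d) :
    ∫ ω, (inner ℝ θ ω : ℝ) ^ 2 ∂(prior d) = ‖θ‖ ^ 2 := by
  simp_rw [sq (inner ℝ θ _ : ℝ)]
  rw [integral_inner_mul_inner_prior, real_inner_self_eq_norm_sq]

/-- No integrability is needed, since a non-integrable utility has integral `0`. This bound is the
source of `B ≤ I`. -/
lemma bestUtility_nonpos (θ : State d) (ν : Measure (State d)) : bestUtility θ ν ≤ 0 :=
  Real.iSup_nonpos fun a => integral_nonpos fun ω => by
    simp only [utility, Pi.zero_apply]; nlinarith [sq_nonneg (inner ℝ θ ω - a)]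

/-- Bias–variance decomposition: the best action is the mean of `θᵀω`, and the remaining loss is its
variance. -/
lemma bestUtility_eq (θ : State d) (ν : Measure (State d)) [IsProbabilityMeasure ν]
    (h : MemLp (fun ω => (inner ℝ θ ω : ℝ)) 2 ν) :
    bestUtility θ ν = (∫ ω, (inner ℝ θ ω : ℝ) ∂ν) ^ 2 - ∫ ω, (inner ℝ θ ω : ℝ) ^ 2 ∂ν := by
  have h1 := h.integrable one_le_two
  have key (a : ℝ) : ∫ ω, utility θ ω a ∂ν =
      (∫ ω, (inner ℝ θ ω : ℝ) ∂ν) ^ 2 - ∫ ω, (inner ℝ θ ω : ℝ) ^ 2 ∂ν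
        - (∫ ω, (inner ℝ θ ω : ℝ) ∂ν - a) ^ 2 := by
    have e (ω : State d) : utility θ ω a
        = 2 * a * inner ℝ θ ω - (inner ℝ θ ω : ℝ) ^ 2 - a ^ 2 := by
      simp only [utility]; ring
    simp_rw [e]
    have h2 : Integrable (fun ω : State d => 2 * a * inner ℝ θ ω) ν := h1.const_mul _
    have h3 : Integrable (fun ω : State d => 2 * a * inner ℝ θ ω - (inner ℝ θ ω : ℝ) ^ 2) ν :=
      h2.sub h.integrable_sq
    rw [integral_sub h3 (integrable_const _), integral_sub h2 h.integrable_sq, integral_const_mul]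
    simp
    ring
  refine le_antisymm (ciSup_le fun a => ?_) ?_
  · rw [key]; linarith [sq_nonneg (∫ ω, (inner ℝ θ ω : ℝ) ∂ν - a)]
  · refine le_ciSup_of_le ⟨0, ?_⟩ (∫ ω, (inner ℝ θ ω : ℝ) ∂ν) (by rw [key]; simp)
    rintro _ ⟨a, rfl⟩
    exact integral_nonpos fun ω => by
      simp only [utility, Pi.zero_apply]; nlinarith [sq_nonneg (inner ℝ θ ω - a)]

lemma bestUtility_prior (θ : State d) : bestUtility θ (prior d) = -‖θ‖ ^ 2 := by
  rw [bestUtility_eq θ _ (memLp_inner_prior θ), integral_inner_prior, integral_inner_sq_prior]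
  ring

namespace Experiment

/-- The mean of the posterior belief. -/
def posteriorMean (E : Experiment.{u} d) (s : E.Signal) : State d :=
  ∫ ω, ω ∂(E.posteriorBelief s)

instance (E : Experiment.{u} d) (s : E.Signal) : IsProbabilityMeasure (E.posteriorBelief s) :=
  inferInstanceAs (IsProbabilityMeasure (posterior E.kernel (prior d) s))

instance (E : Experiment.{u} d) : IsProbabilityMeasure E.signalLaw :=
  inferInstanceAs (IsProbabilityMeasure ((prior d).bind E.kernel))

lemma signalLaw_compProd_posterior (E : Experiment.{u} d) :
    E.signalLaw ⊗ₘ (posterior E.kernel (prior d)) = (prior d ⊗ₘ E.kernel).map Prod.swap :=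
  compProd_posterior_eq_map_swap

lemma map_snd_compProd_posterior (E : Experiment.{u} d) :
    (E.signalLaw ⊗ₘ (posterior E.kernel (prior d))).map Prod.snd = prior d := by
  change Measure.snd _ = _
  rw [signalLaw_compProd_posterior, Measure.snd_map_swap, Measure.fst_compProd]

lemma integrable_compProd_posterior (E : Experiment.{u} d) {F : Type*} [NormedAddCommGroup F]
    {g : State d → F} (hg : Integrable g (prior d)) :
    Integrable (fun p : E.Signal × State d => g p.2)
      (E.signalLaw ⊗ₘ (posterior E.kernel (prior d))) := by
  rw [← map_snd_compProd_posterior E] at hg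
  exact hg.comp_measurable measurable_snd

lemma integral_integral_posteriorBelief (E : Experiment.{u} d) {g : State d → ℝ}
    (hg : Integrable g (prior d)) :
    ∫ s, ∫ ω, g ω ∂(E.posteriorBelief s) ∂E.signalLaw = ∫ ω, g ω ∂(prior d) := by
  have h := Measure.integral_compProd (E.integrable_compProd_posterior hg)
  have h' := hg
  rw [← map_snd_compProd_posterior E] at h'
  refine h.symm.trans ?_
  conv_rhs => rw [← map_snd_compProd_posterior E]
  rw [integral_map measurable_snd.aemeasurable h'.aestronglyMeasurable]

/-- The posterior second moments average to the finite prior one, so almost all of them are finite.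
-/
lemma ae_memLp_posteriorBelief (E : Experiment.{u} d) :
    ∀ᵐ s ∂E.signalLaw, MemLp id 2 (E.posteriorBelief s) := by
  have h : Integrable (fun ω : State d => ‖ω‖ ^ 2) (prior d) :=
    (IsGaussian.memLp_two_id (μ := stdGaussian (State d))).norm.integrable_sq
  have h2 := (Measure.integrable_compProd_iff
    (E.integrable_compProd_posterior h).aestronglyMeasurable).1
    (E.integrable_compProd_posterior h)
  filter_upwards [h2.1] with s hs
  exact (memLp_two_iff_integrable_sq_norm measurable_id.aestronglyMeasurable).2 hs

lemma inner_posteriorMean (E : Experiment.{u} d) (θ : State d) {s : E.Signal}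
    (hs : MemLp id 2 (E.posteriorBelief s)) :
    (inner ℝ θ (E.posteriorMean s) : ℝ) = ∫ ω, inner ℝ θ ω ∂(E.posteriorBelief s) :=
  (integral_inner (hs.integrable one_le_two) θ).symm

lemma aestronglyMeasurable_posteriorMean (E : Experiment.{u} d) :
    AEStronglyMeasurable E.posteriorMean E.signalLaw :=
  (E.integrable_compProd_posterior (g := id)
    ((IsGaussian.memLp_two_id (μ := stdGaussian (State d))).integrable
      one_le_two)).integral_compProd.aestronglyMeasurable

lemma sq_integral_le {ν : Measure (State d)} [IsProbabilityMeasure ν] (θ : State d)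
    (h : MemLp (fun ω => (inner ℝ θ ω : ℝ)) 2 ν) :
    (∫ ω, (inner ℝ θ ω : ℝ) ∂ν) ^ 2 ≤ ∫ ω, (inner ℝ θ ω : ℝ) ^ 2 ∂ν := by
  linarith [bestUtility_eq θ ν h, bestUtility_nonpos θ ν]

lemma integrable_integral_sq_posteriorBelief (E : Experiment.{u} d) (θ : State d) :
    Integrable (fun s => ∫ ω, (inner ℝ θ ω : ℝ) ^ 2 ∂(E.posteriorBelief s)) E.signalLaw :=
  (E.integrable_compProd_posterior (memLp_inner_prior θ).integrable_sq).integral_compProd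

lemma memLp_inner_posteriorMean (E : Experiment.{u} d) (θ : State d) :
    MemLp (fun s => (inner ℝ θ (E.posteriorMean s) : ℝ)) 2 E.signalLaw := by
  have hm : AEStronglyMeasurable (fun s => (inner ℝ θ (E.posteriorMean s) : ℝ)) E.signalLaw :=
    aestronglyMeasurable_const.inner E.aestronglyMeasurable_posteriorMean
  rw [memLp_two_iff_integrable_sq hm]
  refine (E.integrable_integral_sq_posteriorBelief θ).mono' (hm.pow 2) ?_
  filter_upwards [E.ae_memLp_posteriorBelief] with s hs
  rw [Real.norm_of_nonneg (sq_nonneg _), E.inner_posteriorMean θ hs]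
  exact sq_integral_le θ (hs.const_inner θ)

lemma value_eq (E : Experiment.{u} d) (θ : State d) :
    E.value θ = ∫ s, (inner ℝ θ (E.posteriorMean s) : ℝ) ^ 2 ∂E.signalLaw - ‖θ‖ ^ 2 := by
  have h : E.value θ = ∫ s, ((inner ℝ θ (E.posteriorMean s) : ℝ) ^ 2
      - ∫ ω, (inner ℝ θ ω : ℝ) ^ 2 ∂(E.posteriorBelief s)) ∂E.signalLaw := by
    refine integral_congr_ae ?_
    filter_upwards [E.ae_memLp_posteriorBelief] with s hs
    rw [E.inner_posteriorMean θ hs]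
    exact bestUtility_eq θ _ (hs.const_inner θ)
  rw [h, integral_sub (E.memLp_inner_posteriorMean θ).integrable_sq
    (E.integrable_integral_sq_posteriorBelief θ),
    E.integral_integral_posteriorBelief (memLp_inner_prior θ).integrable_sq,
    integral_inner_sq_prior]

/-- A function of the signal with the averages of `θᵀω` is the posterior mean of `θᵀω`, so it
determines the value of the experiment. -/
lemma value_eq_of_setIntegral_eq (E : Experiment.{u} d) (θ : State d) {g : E.Signal → ℝ}
    (hg : Integrable g E.signalLaw)
    (h : ∀ A, MeasurableSet A → ∫ p in Prod.snd ⁻¹' A, (inner ℝ θ p.1 : ℝ)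
      ∂(prior d ⊗ₘ E.kernel) = ∫ s in A, g s ∂E.signalLaw) :
    E.value θ = ∫ s, g s ^ 2 ∂E.signalLaw - ‖θ‖ ^ 2 := by
  have hae : (fun s => (inner ℝ θ (E.posteriorMean s) : ℝ)) =ᵐ[E.signalLaw] g := by
    refine ae_eq_of_forall_setIntegral_eq_of_sigmaFinite
      (fun A _ _ => ((E.memLp_inner_posteriorMean θ).integrable one_le_two).integrableOn)
      (fun A _ _ => hg.integrableOn) fun A hA _ => ?_
    have h1 : ∫ s in A, (inner ℝ θ (E.posteriorMean s) : ℝ) ∂E.signalLaw =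
        ∫ s in A, ∫ ω, inner ℝ θ ω ∂(posterior E.kernel (prior d) s) ∂E.signalLaw := by
      refine setIntegral_congr_ae hA ?_
      filter_upwards [E.ae_memLp_posteriorBelief] with s hs _
      exact E.inner_posteriorMean θ hs
    have hθ := E.integrable_compProd_posterior ((memLp_inner_prior θ).integrable one_le_two)
    have h2 := Measure.setIntegral_compProd (s := A) (t := Set.univ) hA MeasurableSet.univ
      hθ.integrableOn
    simp only [Measure.restrict_univ] at h2
    rw [h1, ← h2, signalLaw_compProd_posterior, setIntegral_map (hA.prod MeasurableSet.univ)
      (by fun_prop) measurable_swap.aemeasurable, ← h A hA]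
    congr 2
    ext p; simp
  rw [E.value_eq]
  congr 1
  refine integral_congr_ae ?_
  filter_upwards [hae] with s hs
  rw [hs]

lemma value_nonpos (E : Experiment.{u} d) (θ : State d) : E.value θ ≤ 0 :=
  integral_nonpos fun _ => bestUtility_nonpos _ _

/-- Every experiment can be replaced by one rank-one direction `w` in the unit ball that keeps
its value for the given type `θ₀` and does not raise its value for any other type. -/
lemma exists_rankOne (E : Experiment.{u} d) (θ₀ : State d) :
    ∃ w : State d, ‖w‖ ≤ 1 ∧ (inner ℝ w θ₀ : ℝ) ^ 2 = E.value θ₀ + ‖θ₀‖ ^ 2 ∧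
      ∀ θ, (inner ℝ w θ : ℝ) ^ 2 ≤ E.value θ + ‖θ‖ ^ 2 := by
  set g : State d → E.Signal → ℝ := fun θ s => inner ℝ θ (E.posteriorMean s) with hg
  have hL (θ) : MemLp (g θ) 2 E.signalLaw := E.memLp_inner_posteriorMean θ
  have hB (θ) : E.value θ + ‖θ‖ ^ 2 = ∫ s, g θ s ^ 2 ∂E.signalLaw := by
    rw [E.value_eq]; ring
  have hB0 (θ) : 0 ≤ ∫ s, g θ s ^ 2 ∂E.signalLaw := integral_nonneg fun _ => sq_nonneg _
  have hB1 (θ) : ∫ s, g θ s ^ 2 ∂E.signalLaw ≤ ‖θ‖ ^ 2 := by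
    linarith [hB θ, E.value_nonpos θ]
  have hmul (θ η) : Integrable (fun s => g θ s * g η s) E.signalLaw :=
    (hL θ).integrable_mul (hL η)
  have hCS (θ η) : (∫ s, g θ s * g η s ∂E.signalLaw) ^ 2 ≤
      (∫ s, g θ s ^ 2 ∂E.signalLaw) * ∫ s, g η s ^ 2 ∂E.signalLaw := by
    -- Cauchy–Schwarz from the discriminant of the nonnegative quadratic `x ↦ ∫ (x g_θ + g_η)²`.
    have h (x : ℝ) : 0 ≤ (∫ s, g θ s ^ 2 ∂E.signalLaw) * (x * x)
        + (2 * ∫ s, g θ s * g η s ∂E.signalLaw) * x + ∫ s, g η s ^ 2 ∂E.signalLaw := by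
      have e : 0 ≤ ∫ s, (x * g θ s + g η s) ^ 2 ∂E.signalLaw :=
        integral_nonneg fun _ => sq_nonneg _
      have e2 (s) : (x * g θ s + g η s) ^ 2 =
        (x * x) * g θ s ^ 2 + (2 * x) * (g θ s * g η s) + g η s ^ 2 := by ring
      simp_rw [e2] at e
      have i1 : Integrable (fun s => (x * x) * g θ s ^ 2) E.signalLaw :=
        (hL θ).integrable_sq.const_mul _
      have i2 : Integrable (fun s => (2 * x) * (g θ s * g η s)) E.signalLaw :=
        (hmul θ η).const_mul _
      have i3 : Integrable (fun s => (x * x) * g θ s ^ 2 + (2 * x) * (g θ s * g η s))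
        E.signalLaw := i1.add i2
      rw [integral_add i3 (hL η).integrable_sq, integral_add i1 i2, integral_const_mul,
        integral_const_mul] at e
      linarith
    have := discrim_le_zero h
    rw [discrim] at this
    nlinarith
  rcases (hB0 θ₀).eq_or_lt with h0 | h0
  · refine ⟨0, by simp, by rw [hB, ← h0]; simp, fun θ => by rw [hB]; simpa using hB0 θ⟩
  set b := ∫ s, g θ₀ s ^ 2 ∂E.signalLaw with hb
  -- This is `θ ↦ θ₀ᵀBθ / √b`; its Riesz vector is `w = Bθ₀ / √b`.
  let φ : State d →ₗ[ℝ] ℝ :=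
    { toFun := fun θ => (∫ s, g θ₀ s * g θ s ∂E.signalLaw) / √b
      map_add' := fun x y => by
        rw [← add_div, ← integral_add (hmul _ _) (hmul _ _)]
        simp only [hg, inner_add_left, mul_add]
      map_smul' := fun c x => by
        simp only [hg, real_inner_smul_left, RingHom.id_apply, smul_eq_mul]
        rw [← mul_div_assoc, ← integral_const_mul]
        congr 2; ext s; ring }
  set w : State d := (InnerProductSpace.toDual ℝ (State d)).symm φ.toContinuousLinearMap with hw
  have hφ (θ : State d) : (inner ℝ w θ : ℝ) = (∫ s, g θ₀ s * g θ s ∂E.signalLaw) / √b := by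
    rw [hw, InnerProductSpace.toDual_symm_apply]; rfl
  have hle (θ) : (inner ℝ w θ : ℝ) ^ 2 ≤ ∫ s, g θ s ^ 2 ∂E.signalLaw := by
    rw [hφ, div_pow, Real.sq_sqrt h0.le, div_le_iff₀ h0, mul_comm]
    exact hCS θ₀ θ
  refine ⟨w, ?_, ?_, fun θ => (hle θ).trans (hB θ).ge⟩
  -- Testing `wwᵀ ≤ B ≤ I` on `w` itself gives `‖w‖⁴ ≤ ‖w‖²`.
  · have h := (hle w).trans (hB1 w)
    rw [real_inner_self_eq_norm_sq] at h
    by_contra! hlt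
    have h1 : 1 < ‖w‖ ^ 2 := one_lt_pow₀ hlt two_ne_zero
    nlinarith
  · have : ∫ s, g θ₀ s * g θ₀ s ∂E.signalLaw = b := by simp_rw [hb, sq]
    rw [hB, hφ, this, div_pow, Real.sq_sqrt h0.le, sq, mul_div_assoc, div_self h0.ne', mul_one]

end Experiment

end Value

/-! ### The value of a scalar Gaussian experiment -/

section GaussianValue

variable {d : ℕ}

/-- The law of the state together with an independent noise `N(0, σ²)`. -/
def stateNoise (d : ℕ) (σsq : ℝ≥0) : Measure (State d × ℝ) :=
  (prior d).prod (gaussianReal 0 σsq)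

instance (σsq : ℝ≥0) : IsGaussian (stateNoise d σsq) :=
  inferInstanceAs (IsGaussian ((stdGaussian (State d)).prod (gaussianReal 0 σsq)))

instance (σsq : ℝ≥0) : IsProbabilityMeasure (stateNoise d σsq) :=
  inferInstanceAs (IsProbabilityMeasure ((prior d).prod (gaussianReal 0 σsq)))

/-- The signal `vᵀω + ξ`, as a continuous linear function of the state and the noise. -/
def noisySignal (v : State d) : State d × ℝ →L[ℝ] ℝ :=
  (innerSL ℝ v).comp (ContinuousLinearMap.fst ℝ _ _) + ContinuousLinearMap.snd ℝ _ _

lemma noisySignal_apply (v : State d) (p : State d × ℝ) :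
    noisySignal v p = inner ℝ v p.1 + p.2 := by
  simp [noisySignal]

/-- Realizing the signal as `vᵀω` plus independent noise makes state and signal linear images of one
Gaussian vector. -/
lemma compProd_gaussianKernel (v : State d) (σsq : ℝ≥0) :
    prior d ⊗ₘ gaussianKernel v σsq =
      (stateNoise d σsq).map (fun p => (p.1, noisySignal v p)) := by
  have hT : Measurable (fun p : State d × ℝ => (p.1, noisySignal v p)) := by fun_prop
  ext A hA
  rw [Measure.compProd_apply hA, Measure.map_apply hT hA, stateNoise,
    Measure.prod_apply (hT hA)]
  refine lintegral_congr fun ω => ?_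
  have h : gaussianKernel v σsq ω = (gaussianReal 0 σsq).map ((inner ℝ v ω : ℝ) + ·) := by
    rw [gaussianReal_map_const_add, zero_add]; rfl
  rw [h, Measure.map_apply (by fun_prop) (measurable_prodMk_left hA)]
  simp only [Set.preimage_preimage, noisySignal_apply]

lemma bind_gaussianKernel (v : State d) (σsq : ℝ≥0) :
    (prior d).bind (gaussianKernel v σsq) = (stateNoise d σsq).map (noisySignal v) := by
  rw [← Measure.snd_compProd, compProd_gaussianKernel, Measure.snd,
    Measure.map_map measurable_snd (by fun_prop)]
  rfl

lemma memLp_inner_fst_stateNoise (θ : State d) (σsq : ℝ≥0) :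
    MemLp (fun p : State d × ℝ => (inner ℝ θ p.1 : ℝ)) 2 (stateNoise d σsq) :=
  (memLp_inner_prior θ).comp_fst _

lemma memLp_snd_stateNoise (σsq : ℝ≥0) :
    MemLp (fun p : State d × ℝ => p.2) 2 (stateNoise d σsq) :=
  (IsGaussian.memLp_two_id (μ := gaussianReal 0 σsq)).comp_snd _

lemma memLp_noisySignal (v : State d) (σsq : ℝ≥0) :
    MemLp (noisySignal v) 2 (stateNoise d σsq) :=
  IsGaussian.memLp_dual (stateNoise d σsq) (noisySignal v) 2 (by simp)

lemma integral_inner_fst_stateNoise (θ : State d) (σsq : ℝ≥0) :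
    ∫ p, (inner ℝ θ p.1 : ℝ) ∂(stateNoise d σsq) = 0 := by
  rw [stateNoise, integral_fun_fst (fun ω : State d => (inner ℝ θ ω : ℝ)),
    integral_inner_prior, smul_zero]

lemma integral_noisySignal (v : State d) (σsq : ℝ≥0) :
    ∫ p, noisySignal v p ∂(stateNoise d σsq) = 0 := by
  simp_rw [noisySignal_apply]
  rw [integral_add ((memLp_inner_fst_stateNoise v σsq).integrable one_le_two)
    ((memLp_snd_stateNoise σsq).integrable one_le_two), integral_inner_fst_stateNoise, stateNoise,
    integral_fun_snd (fun x : ℝ => x), integral_id_gaussianReal]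
  simp

lemma integral_inner_fst_mul_noisySignal (θ v : State d) (σsq : ℝ≥0) :
    ∫ p, (inner ℝ θ p.1 : ℝ) * noisySignal v p ∂(stateNoise d σsq) = inner ℝ v θ := by
  have i1 : Integrable (fun p : State d × ℝ => (inner ℝ θ p.1 : ℝ) * inner ℝ v p.1)
      (stateNoise d σsq) :=
    (memLp_inner_fst_stateNoise θ σsq).integrable_mul (memLp_inner_fst_stateNoise v σsq)
  have i2 : Integrable (fun p : State d × ℝ => (inner ℝ θ p.1 : ℝ) * p.2) (stateNoise d σsq) :=
    (memLp_inner_fst_stateNoise θ σsq).integrable_mul (memLp_snd_stateNoise σsq)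
  simp_rw [noisySignal_apply, mul_add]
  rw [integral_add i1 i2, stateNoise,
    integral_fun_fst (fun ω : State d => (inner ℝ θ ω : ℝ) * inner ℝ v ω),
    integral_inner_mul_inner_prior,
    integral_prod_mul (fun ω : State d => (inner ℝ θ ω : ℝ)) (fun x : ℝ => x),
    integral_inner_prior, real_inner_comm]
  simp

lemma integral_snd_sq_stateNoise (σsq : ℝ≥0) :
    ∫ p, p.2 ^ 2 ∂(stateNoise d σsq) = (σsq : ℝ) := by
  rw [stateNoise, integral_fun_snd (fun x : ℝ => x ^ 2)]
  have h := variance_id_gaussianReal (μ := 0) (v := σsq)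
  rw [variance_of_integral_eq_zero aemeasurable_id (by simp)] at h
  simpa using h

lemma integral_noisySignal_sq (v : State d) (σsq : ℝ≥0) :
    ∫ p, noisySignal v p ^ 2 ∂(stateNoise d σsq) = ‖v‖ ^ 2 + σsq := by
  -- Arranged so that the cross term is a moment already computed.
  have e (p : State d × ℝ) : noisySignal v p ^ 2 =
      (2 * (inner ℝ v p.1 * noisySignal v p) - (inner ℝ v p.1 : ℝ) ^ 2) + p.2 ^ 2 := by
    rw [noisySignal_apply]; ring
  have i1 : Integrable (fun p => 2 * (inner ℝ v p.1 * noisySignal v p)) (stateNoise d σsq) :=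
    ((memLp_inner_fst_stateNoise v σsq).integrable_mul (memLp_noisySignal v σsq)).const_mul _
  have i2 := (memLp_inner_fst_stateNoise v σsq).integrable_sq
  have i3 : Integrable (fun p => 2 * (inner ℝ v p.1 * noisySignal v p) - (inner ℝ v p.1 : ℝ) ^ 2)
    (stateNoise d σsq) := i1.sub i2
  simp_rw [e]
  rw [integral_add i3 (memLp_snd_stateNoise σsq).integrable_sq, integral_sub i1 i2,
    integral_const_mul, integral_inner_fst_mul_noisySignal, integral_snd_sq_stateNoise, stateNoise,
    integral_fun_fst (fun ω : State d => (inner ℝ v ω : ℝ) ^ 2), integral_inner_sq_prior,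
    real_inner_self_eq_norm_sq]
  simp
  ring

/-- The residual of `θᵀω` after regression on the signal. -/
def residual (v θ : State d) (c : ℝ) : State d × ℝ →L[ℝ] ℝ :=
  (innerSL ℝ θ).comp (ContinuousLinearMap.fst ℝ _ _) - c • noisySignal v

lemma residual_apply (v θ : State d) (c : ℝ) (p : State d × ℝ) :
    residual v θ c p = inner ℝ θ p.1 - c * noisySignal v p := by
  simp [residual]

lemma integral_residual (v θ : State d) (c : ℝ) (σsq : ℝ≥0) :
    ∫ p, residual v θ c p ∂(stateNoise d σsq) = 0 := by
  simp_rw [residual_apply]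
  rw [integral_sub ((memLp_inner_fst_stateNoise θ σsq).integrable one_le_two)
    (((memLp_noisySignal v σsq).integrable one_le_two).const_mul c), integral_const_mul,
    integral_inner_fst_stateNoise, integral_noisySignal]
  simp

/-- The coefficient is covariance over variance, so residual and signal are uncorrelated; being
jointly Gaussian, they are independent. -/
lemma indepFun_residual_noisySignal (v θ : State d) {σsq : ℝ≥0}
    (h : 0 < ‖v‖ ^ 2 + (σsq : ℝ)) :
    IndepFun (residual v θ (inner ℝ v θ / (‖v‖ ^ 2 + σsq))) (noisySignal v)
      (stateNoise d σsq) := by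
  set c : ℝ := inner ℝ v θ / (‖v‖ ^ 2 + σsq) with hc
  have hG : HasGaussianLaw (fun p => (residual v θ c p, noisySignal v p)) (stateNoise d σsq) :=
    (IsGaussian.hasGaussianLaw_id (μ := stateNoise d σsq)).map_fun
      ((residual v θ c).prod (noisySignal v))
  refine hG.indepFun_of_covariance_eq_zero ?_
  rw [covariance_eq_sub hG.fst.memLp_two hG.snd.memLp_two, integral_residual, zero_mul, sub_zero]
  have e (p : State d × ℝ) : (⇑(residual v θ c) * ⇑(noisySignal v)) p =
      inner ℝ θ p.1 * noisySignal v p - c * noisySignal v p ^ 2 := by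
    rw [Pi.mul_apply, residual_apply]; ring
  have i1 : Integrable (fun p => (inner ℝ θ p.1 : ℝ) * noisySignal v p) (stateNoise d σsq) :=
    (memLp_inner_fst_stateNoise θ σsq).integrable_mul (memLp_noisySignal v σsq)
  simp_rw [e]
  rw [integral_sub i1 ((memLp_noisySignal v σsq).integrable_sq.const_mul c), integral_const_mul,
    integral_inner_fst_mul_noisySignal, integral_noisySignal_sq, hc, div_mul_cancel₀ _ h.ne',
    sub_self]

/-- By independence the integral factors through the zero mean of the residual. Hence `c * s` is the
posterior mean of `θᵀω`. -/
lemma setIntegral_residual (v θ : State d) {σsq : ℝ≥0} (h : 0 < ‖v‖ ^ 2 + (σsq : ℝ))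
    {A : Set ℝ} (hA : MeasurableSet A) :
    ∫ p in noisySignal v ⁻¹' A, residual v θ (inner ℝ v θ / (‖v‖ ^ 2 + σsq)) p
      ∂(stateNoise d σsq) = 0 := by
  set c : ℝ := inner ℝ v θ / (‖v‖ ^ 2 + σsq) with hc
  have hm : Measurable (A.indicator (fun _ => (1 : ℝ))) := measurable_const.indicator hA
  have hi := (indepFun_residual_noisySignal v θ h).comp measurable_id hm
  rw [← integral_indicator ((noisySignal v).measurable hA)]
  have e (p : State d × ℝ) : (noisySignal v ⁻¹' A).indicator (residual v θ c) p =
      (id ∘ residual v θ c) p * ((A.indicator (fun _ => (1 : ℝ))) ∘ noisySignal v) p := by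
    by_cases hp : noisySignal v p ∈ A <;> simp [Set.indicator, hp]
  simp_rw [e]
  rw [hi.integral_fun_mul_eq_mul_integral
    (by exact (residual v θ c).continuous.aestronglyMeasurable)
    (hm.comp (noisySignal v).measurable).aestronglyMeasurable]
  simp [integral_residual]

lemma value_gaussianExperiment (v θ : State d) {σsq : ℝ≥0} (h : 0 < ‖v‖ ^ 2 + (σsq : ℝ)) :
    (gaussianExperiment v σsq).value θ =
      (inner ℝ v θ) ^ 2 / (‖v‖ ^ 2 + (σsq : ℝ)) - ‖θ‖ ^ 2 := by
  set c : ℝ := inner ℝ v θ / (‖v‖ ^ 2 + σsq) with hc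
  have hS : Measurable (noisySignal v) := (noisySignal v).measurable
  have hint : Integrable (fun s : ℝ => c * s) ((prior d).bind (gaussianKernel v σsq)) := by
    rw [bind_gaussianKernel]
    exact ((integrable_map_measure measurable_id.aestronglyMeasurable hS.aemeasurable).2
      ((memLp_noisySignal v σsq).integrable one_le_two)).const_mul c
  have hset (A : Set ℝ) (hA : MeasurableSet A) :
      ∫ p in Prod.snd ⁻¹' A, (inner ℝ θ p.1 : ℝ) ∂(prior d ⊗ₘ gaussianKernel v σsq) =
        ∫ s in A, c * s ∂((prior d).bind (gaussianKernel v σsq)) := by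
    rw [compProd_gaussianKernel, bind_gaussianKernel, setIntegral_map (measurable_snd hA)
      (by fun_prop) (by fun_prop), setIntegral_map hA (by fun_prop) hS.aemeasurable]
    have h3 := setIntegral_residual v θ h hA
    rw [← hc] at h3
    simp_rw [residual_apply] at h3
    rw [integral_sub ((memLp_inner_fst_stateNoise θ σsq).integrable one_le_two).integrableOn
      (((memLp_noisySignal v σsq).integrable one_le_two).const_mul c).integrableOn,
      sub_eq_zero] at h3
    exact h3
  have hsq : ∫ s : ℝ, (c * s) ^ 2 ∂((prior d).bind (gaussianKernel v σsq)) =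
      (inner ℝ v θ) ^ 2 / (‖v‖ ^ 2 + (σsq : ℝ)) := by
    rw [bind_gaussianKernel, integral_map hS.aemeasurable (by fun_prop)]
    simp_rw [mul_pow]
    rw [integral_const_mul, integral_noisySignal_sq, hc]
    field_simp
  exact ((gaussianExperiment v σsq).value_eq_of_setIntegral_eq θ hint hset).trans
    (congrArg (· - ‖θ‖ ^ 2) hsq)

end GaussianValue

/-! ### Reduction to a compact optimization problem -/

section Optimization

variable {d n : ℕ}

/-- The direct mechanisms `(w, t)` with directions in the unit ball and nonnegative prices that
are incentive compatible and individually rational. -/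
def feasibleMechanisms (θ : Fin n → State d) : Set ((Fin n → State d) × (Fin n → ℝ)) :=
  {p | (∀ i, ‖p.1 i‖ ≤ 1) ∧ (∀ i, 0 ≤ p.2 i) ∧
    -- Values are counted as gains over acting on the prior, so the common term `-‖θ i‖ ^ 2` drops
    -- out.
    (∀ i, p.2 i ≤ (inner ℝ (p.1 i) (θ i) : ℝ) ^ 2) ∧
    ∀ i j, (inner ℝ (p.1 j) (θ i) : ℝ) ^ 2 - p.2 j ≤ (inner ℝ (p.1 i) (θ i) : ℝ) ^ 2 - p.2 i}

lemma isClosed_feasibleMechanisms (θ : Fin n → State d) : IsClosed (feasibleMechanisms θ) := by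
  simp only [feasibleMechanisms, Set.ofPred_and, Set.ofPred_forall]
  refine ((isClosed_iInter fun i => ?_).inter ((isClosed_iInter fun i => ?_).inter
    ((isClosed_iInter fun i => ?_).inter (isClosed_iInter fun i => isClosed_iInter fun j => ?_))))
  all_goals exact isClosed_le (by fun_prop) (by fun_prop)

/-- Individual rationality caps each price by `‖θ i‖ ^ 2`, because the directions lie in the unit
ball. -/
lemma isCompact_feasibleMechanisms (θ : Fin n → State d) : IsCompact (feasibleMechanisms θ) := by
  have hK : IsCompact ((Set.univ.pi fun _ : Fin n => Metric.closedBall (0 : State d) 1) ×ˢ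
      (Set.univ.pi fun i : Fin n => Set.Icc (0 : ℝ) (‖θ i‖ ^ 2))) :=
    (isCompact_univ_pi fun _ => isCompact_closedBall _ _).prod
      (isCompact_univ_pi fun _ => isCompact_Icc)
  refine hK.of_isClosed_subset (isClosed_feasibleMechanisms θ) ?_
  rintro ⟨w, t⟩ ⟨h1, h2, h3, -⟩
  refine ⟨fun i _ => by simpa using h1 i, fun i _ => ⟨h2 i, (h3 i).trans ?_⟩⟩
  have h := abs_real_inner_le_norm (w i) (θ i)
  rw [← sq_abs]
  gcongr
  exact h.trans (mul_le_of_le_one_left (norm_nonneg _) (h1 i))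

lemma exists_isMaxOn_feasibleMechanisms (θ : Fin n → State d) (f : Fin n → ℝ) :
    ∃ p ∈ feasibleMechanisms θ, ∀ q ∈ feasibleMechanisms θ,
      ∑ i, f i * q.2 i ≤ ∑ i, f i * p.2 i := by
  have hne : (feasibleMechanisms θ).Nonempty := ⟨0, by simp [feasibleMechanisms]⟩
  obtain ⟨p, hp, hmax⟩ := (isCompact_feasibleMechanisms θ).exists_isMaxOn hne
    (f := fun p => ∑ i, f i * p.2 i) (by fun_prop)
  exact ⟨p, hp, fun q hq => hmax hq⟩

/-- The optimal purchases in any menu have the payments of a feasible direct mechanism. -/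
lemma Menu.IsOptimalChoice.exists_feasible {M : Menu.{u, w} d} {θ : Fin n → State d}
    {c : Fin n → Option M.Item} (hc : M.IsOptimalChoice θ c) :
    ∃ w : Fin n → State d, (w, fun i => M.payment (c i)) ∈ feasibleMechanisms θ := by
  -- Buying nothing counts as direction `0` at price `0`. The equality preserves the type's own
  -- payoff; the inequality for all `η` controls deviations.
  have key (i : Fin n) : ∃ w : State d, ‖w‖ ≤ 1 ∧
      (inner ℝ w (θ i) : ℝ) ^ 2 - M.payment (c i) = M.netUtility (θ i) (c i) + ‖θ i‖ ^ 2 ∧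
      ∀ η, (inner ℝ w η : ℝ) ^ 2 - M.payment (c i) ≤ M.netUtility η (c i) + ‖η‖ ^ 2 := by
    rcases c i with _ | j
    · exact ⟨0, by simp, by simp [Menu.netUtility, Menu.payment, bestUtility_prior],
        fun η => by simp [Menu.netUtility, Menu.payment, bestUtility_prior]⟩
    · obtain ⟨w, h1, h2, h3⟩ := (M.experiment j).exists_rankOne (θ i)
      refine ⟨w, h1, ?_, fun η => ?_⟩
      · simp only [Menu.netUtility, Menu.payment]; linarith
      · simp only [Menu.netUtility, Menu.payment]; linarith [h3 η]
  choose w h1 h2 h3 using key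
  refine ⟨w, h1, fun i => ?_, fun i => ?_, fun i j => ?_⟩
  · change 0 ≤ M.payment (c i)
    rcases c i with _ | j <;> simp [Menu.payment]
  · have h : bestUtility (θ i) (prior d) ≤ M.netUtility (θ i) (c i) := hc i none
    rw [bestUtility_prior] at h
    linarith [h2 i]
  · linarith [hc i (c j), h2 i, h3 j (θ i)]

end Optimization

end

end InfoPricing

/-! ### The optimal Gaussian menu -/

theorem theorem2 (d n : ℕ) (θ : Fin n → InfoPricing.State d) (f : Fin n → ℝ)
    (hf : f ∈ stdSimplex ℝ (Fin n)) :
    ∃ (v : Fin n → InfoPricing.State d) (σsq : Fin n → ℝ≥0) (t : Fin n → ℝ≥0),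
      InfoPricing.Menu.IsRevenueMaximizing.{0, 0, u, w}
          (InfoPricing.Menu.direct
            (fun i => InfoPricing.gaussianExperiment (v i) (σsq i)) t) θ f
          (fun i => some i) ∧
        ∀ j : Fin n, 0 < ‖v j‖ ^ 2 + (σsq j : ℝ) ∧
          ∀ i : Fin n,
            (InfoPricing.gaussianExperiment (v j) (σsq j)).value (θ i) =
              (inner ℝ (v j) (θ i)) ^ 2 / (‖v j‖ ^ 2 + (σsq j : ℝ)) - ‖θ i‖ ^ 2 := by
  obtain ⟨⟨v, t⟩, ⟨hv, ht, hir, hic⟩, hmax⟩ :=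
    InfoPricing.exists_isMaxOn_feasibleMechanisms θ f
  simp only at hv ht hir hic hmax
  have hsq (i : Fin n) : ‖v i‖ ^ 2 ≤ 1 := pow_le_one₀ (norm_nonneg _) (hv i)
  -- The noise tops the signal variance up to `1`, which removes the denominator and also keeps it
  -- positive when `v j = 0`.
  have hone (j : Fin n) : ‖v j‖ ^ 2 + ((1 - ‖v j‖ ^ 2).toNNReal : ℝ) = 1 := by
    rw [Real.coe_toNNReal _ (sub_nonneg.2 (hsq j))]; ring
  have hval (j : Fin n) (η : InfoPricing.State d) :
      (InfoPricing.gaussianExperiment (v j) (1 - ‖v j‖ ^ 2).toNNReal).value η =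
        (inner ℝ (v j) η) ^ 2 - ‖η‖ ^ 2 := by
    rw [InfoPricing.value_gaussianExperiment _ _ (by rw [hone]; exact one_pos), hone, div_one]
  refine ⟨v, fun i => (1 - ‖v i‖ ^ 2).toNNReal, fun i => (t i).toNNReal, ⟨?_, ?_⟩, fun j => ?_⟩
  · rintro i (_ | j)
    · simp only [InfoPricing.Menu.netUtility, InfoPricing.Menu.direct,
        InfoPricing.bestUtility_prior, hval, Real.coe_toNNReal _ (ht i)]
      linarith [hir i]
    · change Fin n at j
      simp only [InfoPricing.Menu.netUtility, InfoPricing.Menu.direct, hval,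
        Real.coe_toNNReal _ (ht _)]
      linarith [hic i j]
  · intro M' c' hc'
    obtain ⟨w, hw⟩ := hc'.exists_feasible
    simpa [InfoPricing.Menu.revenue, InfoPricing.Menu.payment, InfoPricing.Menu.direct,
      Real.coe_toNNReal _ (ht _)] using hmax _ hw
  · have hpos : 0 < ‖v j‖ ^ 2 + ((1 - ‖v j‖ ^ 2).toNNReal : ℝ) := by rw [hone]; exact one_pos
    exact ⟨hpos, fun i => InfoPricing.value_gaussianExperiment _ _ hpos⟩
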